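/- A tournament $T$ on $n$ vertices has exactly one arc between any two distinct vertices; $u$ beats $v$ if the arc goes from $u$ to $v$. A Copeland winner (champion) is a vertex that wins the largest number of matches, and $\ell(T)$ denotes the number of matches lost by a champion of $T$; one always has $0\le \ell(T)\le (n-1)/2$. A deterministic algorithm is a finite binary decision tree that adaptively unfolds arcs (each lookup of a pair $u,v$ reveals which of the two beats the other, at unit cost, repetitions counted) and finally outputs a vertex; a randomized (Monte Carlo) algorithm is a probability distribution over deterministic algorithms. The algorithm is not told $\ell(T)$. **Theorem.** No randomized algorithm that unfolds $o(\ell n)$ arcs outputs a Copeland winner with fixed positive probability. Precisely: for every $p>0$ there are a constant $c>0$ and an integer $N$, depending only on $p$, such that the following holds for every $n\ge N$. Let $A$ be a randomized algorithm which, on every tournament on the vertex set $\{0,\dots,n-1\}$, outputs a Copeland winner of that tournament with probability at least $p$. Then for every integer $\ell\ge 0$ with $2\ell+1\le n$ there is a tournament $T$ on $\{0,\dots,n-1\}$ with $\ell(T)=\ell$ on which the expected number of arcs unfolded by $A$ is greater than $c\,\ell\,n$ (so, for some outcome of the coins, $A$ unfolds more than $c\,\ell\,n$ arcs on $T$). 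-/

import Mathlib

open scoped ENNReal

/-- A tournament on the vertex set `V`: between two distinct vertices there is exactly one arc.
`beats u v = true` means that the arc goes from `u` to `v`, that is, `u` wins against `v`. -/
structure Tournament (V : Type*) where
  beats : V → V → Bool
  irrefl : ∀ v, beats v v = false
  compl : ∀ u v, u ≠ v → beats v u = !beats u v

namespace Tournament

variable {V : Type*} [Fintype V]

/-- The number of matches won by `v` (its out-degree). -/
def wins (T : Tournament V) (v : V) : ℕ :=
  (Finset.univ.filter fun w => T.beats v w = true).card

/-- The number of matches lost by `v` (its in-degree). -/
def losses (T : Tournament V) (v : V) : ℕ :=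
  (Finset.univ.filter fun w => T.beats w v = true).card

/-- A champion, or Copeland winner: a vertex that wins the largest number of matches. -/
def IsChampion (T : Tournament V) (v : V) : Prop :=
  ∀ w, T.wins w ≤ T.wins v

/-- The champions of `T` lose exactly `l` matches. (Two champions lose equally many matches.) -/
def ChampionLoses (T : Tournament V) (l : ℕ) : Prop :=
  ∃ v, T.IsChampion v ∧ T.losses v = l

end Tournament

/-- A deterministic algorithm that probes the adjacency matrix of a tournament on `V`: it either
stops and outputs a vertex, or unfolds the arc between `u` and `v` and continues in a way that
depends on the answer (`ifWin` when `u` beats `v`, `ifLose` otherwise). All computation between two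
lookups is free. -/
inductive LookupTree (V : Type*) where
  | output (v : V) : LookupTree V
  | unfold (u v : V) (ifWin ifLose : LookupTree V) : LookupTree V

namespace LookupTree

variable {V : Type*}

/-- The vertex that the algorithm outputs on the tournament `T`. -/
def result (T : Tournament V) : LookupTree V → V
  | output v => v
  | unfold u v a b => if T.beats u v = true then a.result T else b.result T

/-- The number of arcs that the algorithm unfolds on the tournament `T`. -/
def lookups (T : Tournament V) : LookupTree V → ℕ
  | output _ => 0
  | unfold u v a b => (if T.beats u v = true then a.lookups T else b.lookups T) + 1

end LookupTree

/-- A randomized (Monte Carlo) algorithm: a probability distribution over deterministic ones. -/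
abbrev RandomizedAlgorithm (V : Type*) := PMF (LookupTree V)

namespace RandomizedAlgorithm

variable {V : Type*}

/-- The probability that the algorithm outputs a champion of `T`. -/
noncomputable def successProb [Fintype V] (A : RandomizedAlgorithm V) (T : Tournament V) : ℝ≥0∞ :=
  A.toOuterMeasure {t | T.IsChampion (t.result T)}

/-- The expected number of arcs that the algorithm unfolds on `T`. -/
noncomputable def expectedLookups (A : RandomizedAlgorithm V) (T : Tournament V) : ℝ≥0∞ :=
  ∑' t, A t * (t.lookups T : ℝ≥0∞)

end RandomizedAlgorithm

/-! Correctness is demanded on every tournament, while the cost is assumed small only where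
champions lose `l` matches. So take such a `T` and reverse arcs at a vertex `u` to make `u` the
unique champion; the new tournament may have another value of `l`. A tree that looks up none of
these arcs on `T` answers as on `T`, which is right for only one `u`. Success with probability `p`
for all choices of `u` thus forces many lookups on `T` itself.

Three such arguments suffice. Letting an untouched vertex beat everybody gives a bound linear in
`n`, which settles bounded `l`. If `n ≤ 4l`, let a regular tournament on `2l+1` vertices dominate
the rest: each of its `(2l+1)l` arcs is critical, which costs order `l²`. If `n > 4l`, take a
regular tournament on `2l-1` vertices, each of which also loses to one random outsider. For about a
fraction `p` of these vertices the hidden arc must be found, and each search costs order `n` by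
`mul_card_found_le`. The total has order `l n`. -/

namespace LookupTree

/-! ### Lookup traces and the cost of finding a hidden arc -/

variable {V : Type*}

/-- The pairs of vertices that the algorithm looks up on `T`, in order. -/
def trace (T : Tournament V) : LookupTree V → List (Sym2 V)
  | output _ => []
  | unfold u v a b => s(u, v) :: if T.beats u v = true then a.trace T else b.trace T

theorem length_trace (T : Tournament V) (t : LookupTree V) :
    (t.trace T).length = t.lookups T := by
  induction t with
  | output v => rfl
  | unfold u v a b iha ihb =>
    simp only [trace, lookups, List.length_cons]
    split_ifs <;> simp [*]

/-- The result only depends on the arcs that are looked up. -/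
theorem result_eq_of_agree {T T' : Tournament V} {t : LookupTree V}
    (h : ∀ x y, s(x, y) ∈ t.trace T → T'.beats x y = T.beats x y) :
    t.result T' = t.result T := by
  induction t with
  | output v => rfl
  | unfold u v a b iha ihb =>
    have h0 := h u v (by simp [trace])
    simp only [result, h0]
    simp only [trace, List.mem_cons] at h
    split_ifs with hb
    · exact iha fun x y hxy => h x y (Or.inr (by simpa [hb] using hxy))
    · exact ihb fun x y hxy => h x y (Or.inr (by simpa [hb] using hxy))

/-- The number of lookups that involve the vertex `u`. -/
def lookupsAt [DecidableEq V] (T : Tournament V) (t : LookupTree V) (u : V) : ℕ :=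
  (t.trace T).countP fun e => u ∈ e

theorem sum_lookupsAt_le [Fintype V] [DecidableEq V] (T : Tournament V) (t : LookupTree V) :
    ∑ u, t.lookupsAt T u ≤ 2 * t.lookups T := by
  rw [← length_trace]
  simp only [lookupsAt]
  induction t.trace T with
  | nil => simp
  | cons e l ih =>
    simp only [List.countP_cons, Finset.sum_add_distrib, List.length_cons]
    have : ∑ u : V, (if decide (u ∈ e) = true then 1 else 0) ≤ 2 := by
      induction e with
      | _ x y =>
        have : (Finset.univ.filter fun u => u ∈ s(x, y)) ⊆ {x, y} := by
          intro u; simp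
        simpa using (Finset.card_le_card this).trans Finset.card_le_two
    omega

/-- If the tournaments `T w` differ from a common one only in the arc between `u` and `w`, then an
algorithm needs many lookups at `u` to look up that arc for many `w`. -/
theorem mul_card_found_le [DecidableEq V] (S : Tournament V) (u : V) (T : V → Tournament V)
    (hT : ∀ w x y, s(x, y) ≠ s(u, w) → (T w).beats x y = S.beats x y)
    (t : LookupTree V) (b : ℕ) (W : Finset V) :
    b * (W.filter fun w => s(u, w) ∈ t.trace (T w)).card ≤
      b ^ 2 + ∑ w ∈ W, t.lookupsAt (T w) u := by
  -- Until the arc at `w` is found, the run on `T w` follows the run on `S`. So at most `b` of the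
  -- `w` are found within `b` lookups at `u`, and every other found `w` contributes at least `b` to
  -- the sum.
  induction t generalizing b W with
  | output v => simp [trace]
  | unfold x y a c iha ihc =>
    -- `d` is the continuation shared by all `T w` whose hidden arc is not the one looked up.
    obtain ⟨d, hd, ihd⟩ : ∃ d : LookupTree V,
        (d = if S.beats x y = true then a else c) ∧
        ∀ (b : ℕ) (W : Finset V), b * (W.filter fun w => s(u, w) ∈ d.trace (T w)).card ≤
          b ^ 2 + ∑ w ∈ W, d.lookupsAt (T w) u := by
      refine ⟨_, rfl, ?_⟩
      split_ifs
      exacts [iha, ihc]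
    have htr : ∀ w, s(x, y) ≠ s(u, w) →
        (unfold x y a c).trace (T w) = s(x, y) :: d.trace (T w) := by
      intro w hw
      simp only [trace, hT w x y hw, hd]
      split_ifs <;> rfl
    by_cases hu : u ∈ s(x, y)
    · obtain ⟨z, hz⟩ := hu
      -- This lookup finds only `z`, and every other `w` pays one for it: drop `z` from `W` and
      -- lower `b` by one.
      rcases b with _ | b
      · simp
      have h1 : (W.filter fun w => s(u, w) ∈ (unfold x y a c).trace (T w)) ⊆
          insert z ((W.erase z).filter fun w => s(u, w) ∈ d.trace (T w)) := by
        intro w hw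
        rw [Finset.mem_filter] at hw
        by_cases hwz : w = z
        · simp [hwz]
        · have hne : s(x, y) ≠ s(u, w) := by
            rw [hz]; intro h; exact hwz (Sym2.congr_right.1 h).symm
          rw [htr w hne, List.mem_cons] at hw
          simp only [Finset.mem_insert, Finset.mem_filter, Finset.mem_erase]
          exact Or.inr ⟨⟨hwz, hw.1⟩, hw.2.resolve_left fun h => hne h.symm⟩
      have h2 := (Finset.card_le_card h1).trans (Finset.card_insert_le _ _)
      have h3 := ihd b (W.erase z)
      have h4 : ∑ w ∈ W.erase z, (d.lookupsAt (T w) u + 1) ≤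
          ∑ w ∈ W, (unfold x y a c).lookupsAt (T w) u := by
        refine (Finset.sum_le_sum fun w hw => ?_).trans
          (Finset.sum_le_sum_of_subset (Finset.erase_subset z W))
        have hne : s(x, y) ≠ s(u, w) := by
          rw [hz]; intro h; exact (Finset.mem_erase.1 hw).1 (Sym2.congr_right.1 h).symm
        simp [lookupsAt, htr w hne, hz]
      rw [Finset.sum_add_distrib, Finset.sum_const, smul_eq_mul, mul_one] at h4
      have h5 := Finset.card_filter_le (W.erase z) fun w => s(u, w) ∈ d.trace (T w)
      set q := ((W.erase z).filter fun w => s(u, w) ∈ d.trace (T w)).card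
      calc _ ≤ (b + 1) * (q + 1) := Nat.mul_le_mul_left _ h2
        _ = b * q + q + b + 1 := by ring
        _ ≤ _ := by nlinarith
    · have hne : ∀ w, s(x, y) ≠ s(u, w) := by
        intro w h; rw [h] at hu; simp at hu
      have h := ihd b W
      have e1 : ∀ w, (s(u, w) ∈ (unfold x y a c).trace (T w) ↔ s(u, w) ∈ d.trace (T w)) := by
        intro w
        rw [htr w (hne w), List.mem_cons]
        exact or_iff_right fun h => hne w h.symm
      have e2 : ∀ w, (unfold x y a c).lookupsAt (T w) u = d.lookupsAt (T w) u := by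
        intro w
        simp [lookupsAt, htr w (hne w), hu]
      simpa only [e1, e2] using h

end LookupTree

/-! ### From deterministic trees to distributions -/

namespace RandomizedAlgorithm

variable {V : Type*} [Fintype V]

/-- A counting bound for deterministic algorithms turns into one for randomized algorithms. -/
theorem mul_card_mul_le {ι κ : Type*} (A : RandomizedAlgorithm V) {p : ℝ≥0∞}
    (hA : ∀ T : Tournament V, p ≤ successProb A T) (I : Finset ι) (J : Finset κ)
    (S : ι → Tournament V) (v : ι → V) (T : κ → Tournament V) [DecidableEq V]
    (hS : ∀ i ∈ I, ∀ w, (S i).IsChampion w → w = v i) (K a d : ℕ)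
    (h : ∀ t : LookupTree V,
      K * (I.filter fun i => t.result (S i) = v i).card ≤ a + d * ∑ k ∈ J, t.lookups (T k)) :
    (K : ℝ≥0∞) * I.card * p ≤ a + d * ∑ k ∈ J, expectedLookups A (T k) := by
  have h1 : ∀ i ∈ I, p ≤ ∑' t, A t * (if t.result (S i) = v i then 1 else 0) := by
    intro i hi
    refine (hA (S i)).trans ?_
    rw [successProb, PMF.toOuterMeasure_apply]
    refine ENNReal.tsum_le_tsum fun t => ?_
    by_cases ht : (S i).IsChampion (t.result (S i))
    · rw [if_pos (hS i hi _ ht), mul_one]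
      exact Set.indicator_le_self' (by simp) t
    · rw [Set.indicator_of_notMem ht]
      exact zero_le
  calc (K : ℝ≥0∞) * I.card * p = K * ∑ i ∈ I, p := by simp [mul_assoc]
    _ ≤ K * ∑ i ∈ I, ∑' t, A t * (if t.result (S i) = v i then 1 else 0) := by
        gcongr with i hi; exact h1 i hi
    _ = ∑' t, A t * ((K * (I.filter fun i => t.result (S i) = v i).card : ℕ) : ℝ≥0∞) := by
        rw [← Summable.tsum_finsetSum fun _ _ => ENNReal.summable, ← ENNReal.tsum_mul_left]
        refine tsum_congr fun t => ?_
        rw [← Finset.mul_sum, Finset.sum_boole]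
        push_cast
        ring
    _ ≤ ∑' t, A t * ((a + d * ∑ k ∈ J, t.lookups (T k) : ℕ) : ℝ≥0∞) := by
        gcongr with t; exact_mod_cast h t
    _ = a + d * ∑ k ∈ J, expectedLookups A (T k) := by
        simp only [expectedLookups]
        rw [← Summable.tsum_finsetSum fun _ _ => ENNReal.summable, ← ENNReal.tsum_mul_left]
        push_cast
        simp only [mul_add]
        rw [ENNReal.tsum_add, ENNReal.tsum_mul_right, A.tsum_coe, one_mul]
        congr 1
        refine tsum_congr fun t => ?_
        rw [← Finset.mul_sum]
        ring

/-- The common frame of the three bounds: success is counted on the modified tournaments `S i`,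
lookups on the unmodified `T k`. -/
theorem real_mul_card_mul_le {ι κ : Type*} (A : RandomizedAlgorithm V) {p X : ℝ}
    (hX : 0 ≤ X) (hA : ∀ T : Tournament V, ENNReal.ofReal p ≤ successProb A T)
    (I : Finset ι) (J : Finset κ)
    (S : ι → Tournament V) (v : ι → V) (T : κ → Tournament V) [DecidableEq V]
    (hS : ∀ i ∈ I, ∀ w, (S i).IsChampion w → w = v i) (K a d : ℕ)
    (h : ∀ t : LookupTree V,
      K * (I.filter fun i => t.result (S i) = v i).card ≤ a + d * ∑ k ∈ J, t.lookups (T k))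
    (hT : ∀ k ∈ J, expectedLookups A (T k) ≤ ENNReal.ofReal X) :
    (K : ℝ) * I.card * p ≤ a + d * (J.card * X) := by
  have h1 := mul_card_mul_le A hA I J S v T hS K a d h
  have h2 : (K : ℝ≥0∞) * I.card * ENNReal.ofReal p ≤ a + d * (J.card * ENNReal.ofReal X) := by
    refine h1.trans ?_
    gcongr
    simpa using Finset.sum_le_sum hT
  rw [← ENNReal.ofReal_le_ofReal_iff (by positivity), ENNReal.ofReal_mul (by positivity),
    ENNReal.ofReal_mul (by positivity), ENNReal.ofReal_add (by positivity) (by positivity),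
    ENNReal.ofReal_mul (by positivity), ENNReal.ofReal_mul (by positivity)]
  simpa using h2

end RandomizedAlgorithm

/-! ### Champions and reversed arcs -/

namespace Tournament

theorem wins_add_losses {V : Type*} [Fintype V] (T : Tournament V) (v : V) :
    T.wins v + T.losses v + 1 = Fintype.card V := by
  classical
  have h : T.losses v = (Finset.univ.filter fun w => ¬ T.beats v w = true ∧ w ≠ v).card := by
    unfold losses
    congr 1
    ext w
    by_cases hw : w = v
    · simp [hw, T.irrefl]
    · simp [hw, T.compl v w (Ne.symm hw)]
  have h' : T.losses v + 1 = (Finset.univ.filter fun w => ¬ T.beats v w = true).card := by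
    rw [h, ← Finset.card_insert_of_notMem (a := v) (by simp)]
    congr 1
    ext w
    by_cases hw : w = v
    · simp [hw, T.irrefl]
    · simp [hw]
  have := Finset.card_filter_add_card_filter_not (s := Finset.univ) (fun w => T.beats v w = true)
  rw [← h', Finset.card_univ] at this
  rw [← this, wins]
  ring

theorem isChampion_iff_losses {V : Type*} [Fintype V] (T : Tournament V) (v : V) :
    T.IsChampion v ↔ ∀ w, T.losses v ≤ T.losses w := by
  refine forall_congr' fun w => ?_
  have h1 := T.wins_add_losses v
  have h2 := T.wins_add_losses w
  omega

variable {V : Type*} [DecidableEq V]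

/-- The tournament `T`, changed so that `u` beats all other vertices of `D`. -/
def promote (T : Tournament V) (u : V) (D : Finset V) : Tournament V where
  -- The test `y ≠ u` keeps the diagonal false when `u ∈ D`, as for `D = univ`.
  beats x y := if x = u ∧ y ∈ D then decide (y ≠ u) else if y = u ∧ x ∈ D then false
    else T.beats x y
  irrefl v := by
    have := T.irrefl v
    split_ifs <;> simp_all
  compl x y h := by
    have := T.compl x y h
    split_ifs <;> grind

theorem promote_singleton_beats (T : Tournament V) {u w x y : V} (h : s(x, y) ≠ s(u, w)) :
    (T.promote u {w}).beats x y = T.beats x y := by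
  simp only [ne_eq, Sym2.eq_iff, not_or] at h
  simp only [promote, Finset.mem_singleton]
  rw [if_neg h.1, if_neg (by tauto)]

theorem promote_beats_of_ne (T : Tournament V) {u x y : V} (D : Finset V) (hx : x ≠ u)
    (hy : y ≠ u) : (T.promote u D).beats x y = T.beats x y := by
  simp [promote, hx, hy]

variable [Fintype V]

theorem eq_of_isChampion_promote_univ (T : Tournament V) (u v : V)
    (h : (T.promote u Finset.univ).IsChampion v) : v = u := by
  by_contra hv
  have h1 := (isChampion_iff_losses _ _).1 h u
  have h2 : (T.promote u Finset.univ).losses u = 0 := by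
    simp only [losses, Finset.card_eq_zero, Finset.filter_eq_empty_iff]
    intro w _
    by_cases hw : w = u <;> simp [promote, hw]
  have h3 : 0 < (T.promote u Finset.univ).losses v := by
    refine Finset.card_pos.2 ⟨u, ?_⟩
    simp [promote, hv]
  omega

/-- The reversal takes one loss from `u`, which already had the fewest, and takes none from any
other vertex. -/
theorem eq_of_isChampion_promote_singleton (T : Tournament V) {u w : V} (v : V)
    (hu : T.IsChampion u) (hw : T.beats w u = true)
    (h : (T.promote u {w}).IsChampion v) : v = u := by
  by_contra hv
  have hwu : w ≠ u := by rintro rfl; simp [T.irrefl] at hw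
  have h1 := (isChampion_iff_losses _ _).1 h u
  have h2 : (T.promote u {w}).losses u < T.losses u := by
    refine Finset.card_lt_card (Finset.ssubset_iff_of_subset ?_ |>.2 ⟨w, by simpa, ?_⟩)
    · intro x
      simp only [Finset.mem_filter, Finset.mem_univ, true_and, promote]
      split_ifs <;> simp_all
    · simp [promote, hwu]
  have h3 : T.losses v ≤ (T.promote u {w}).losses v := by
    refine Finset.card_le_card fun x => ?_
    rw [Finset.mem_filter, Finset.mem_filter]
    simp only [Finset.mem_univ, true_and, promote]
    split_ifs <;> simp_all
  have h4 := (isChampion_iff_losses _ _).1 hu v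
  omega

end Tournament

/-! ### Two-block tournaments -/

/-- The vertices below `s` and those from `s` on each form a nearly regular tournament, and `i < s`
beats `j ≥ s` unless `X i j`. -/
def blockTournament (n s : ℕ) (X : Fin n → Fin n → Bool) : Tournament (Fin n) where
  beats i j :=
    if i.val < j.val then
      if i.val < s ∧ s ≤ j.val then !X i j else decide ((j.val - i.val) % 2 = 1)
    else if j.val < i.val then
      if j.val < s ∧ s ≤ i.val then X j i else decide ((i.val - j.val) % 2 = 0)
    else false
  irrefl v := by simp
  compl u v h := by
    have : u.val ≠ v.val := fun h' => h (Fin.ext h')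
    rcases lt_or_gt_of_ne this with h | h
    · have h' := not_lt.2 h.le
      simp only [h, h', if_true, if_false]
      split_ifs
      · simp
      · simp [← decide_not]
    · have h' := not_lt.2 h.le
      simp only [h, h', if_true, if_false]
      split_ifs
      · simp
      · simp [← decide_not]

/-- These `j` are the vertices that beat `u` inside a block. For odd `b - a` the two roundings
cancel, so the count does not depend on `u` and the block is regular. -/
theorem Nat.card_filter_parity (a u b : ℕ) (hau : a ≤ u) (hub : u < b) :
    ((Finset.Ico a b).filter fun j =>
      j < u ∧ (u - j) % 2 = 1 ∨ u < j ∧ (j - u) % 2 = 0).card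
      = (u - a + 1) / 2 + (b - 1 - u) / 2 := by
  -- The induction moves the right end up from `a`, so it also needs a formula for ends that have
  -- not yet passed `u`.
  have key : ∀ b, a ≤ b → ((Finset.Ico a b).filter fun j =>
      j < u ∧ (u - j) % 2 = 1 ∨ u < j ∧ (j - u) % 2 = 0).card
      = if b ≤ u then (u - a + 1) / 2 - (u - b + 1) / 2
        else (u - a + 1) / 2 + (b - 1 - u) / 2 := by
    intro b hb
    induction b, hb using Nat.le_induction with
    | base => simp [hau]
    | succ b hb ih =>
      rw [← Finset.insert_Ico_right_eq_Ico_add_one hb, Finset.filter_insert]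
      split_ifs at ih ⊢ with h1 h2 h3 h4 <;>
        first
        | (rw [Finset.card_insert_of_notMem (by simp), ih]; omega)
        | (rw [ih]; omega)
  rw [key b (by omega), if_neg (by omega)]

theorem Fin.card_filter_parity {n a b : ℕ} (u : Fin n) (hau : a ≤ u.val) (hub : u.val < b)
    (hb : b ≤ n) :
    (Finset.univ.filter fun j : Fin n => (a ≤ j.val ∧ j.val < b) ∧
      (j.val < u.val ∧ (u.val - j.val) % 2 = 1 ∨ u.val < j.val ∧ (j.val - u.val) % 2 = 0)).card
      = (u.val - a + 1) / 2 + (b - 1 - u.val) / 2 := by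
  rw [← Nat.card_filter_parity a u b hau hub, ← Finset.card_map Fin.valEmbedding]
  congr 1
  ext j
  simp only [Finset.mem_map, Finset.mem_filter, Finset.mem_univ, true_and, Fin.valEmbedding_apply,
    Finset.mem_Ico]
  constructor
  · rintro ⟨j, h, rfl⟩
    exact h
  · intro h
    exact ⟨⟨j, by omega⟩, h, rfl⟩

section blockTournament

variable {n s : ℕ} {X : Fin n → Fin n → Bool}

theorem blockTournament_beats_lower {u w : Fin n} (hu : u.val < s) (hw : w.val < s) :
    (blockTournament n s X).beats w u = true ↔
      w.val < u.val ∧ (u.val - w.val) % 2 = 1 ∨ u.val < w.val ∧ (w.val - u.val) % 2 = 0 := by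
  simp only [blockTournament]
  split_ifs <;> simp <;> omega

theorem blockTournament_beats_upper {u w : Fin n} (hu : s ≤ u.val) (hw : s ≤ w.val) :
    (blockTournament n s X).beats w u = true ↔
      w.val < u.val ∧ (u.val - w.val) % 2 = 1 ∨ u.val < w.val ∧ (w.val - u.val) % 2 = 0 := by
  simp only [blockTournament]
  split_ifs <;> simp <;> omega

theorem blockTournament_beats_of_lt_of_le {u w : Fin n} (hu : u.val < s) (hw : s ≤ w.val) :
    (blockTournament n s X).beats w u = X u w := by
  have h1 : u.val < w.val := by omega
  simp only [blockTournament]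
  rw [if_neg h1.not_gt, if_pos h1, if_pos ⟨hu, hw⟩]

theorem blockTournament_beats_of_le_of_lt {u w : Fin n} (hu : s ≤ u.val) (hw : w.val < s) :
    (blockTournament n s X).beats w u = !X w u := by
  have h1 : w.val < u.val := by omega
  simp only [blockTournament]
  rw [if_pos h1, if_pos ⟨hw, hu⟩]

/-- The vertices of the lower block that beat `u`. -/
def lowerBeaters (n s : ℕ) (X : Fin n → Fin n → Bool) (u : Fin n) : Finset (Fin n) :=
  Finset.univ.filter fun w => w.val < s ∧ (blockTournament n s X).beats w u = true

theorem card_lowerBeaters {k : ℕ} (hs : s = 2 * k + 1) (hsn : s ≤ n) {u : Fin n}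
    (hu : u.val < s) : (lowerBeaters n s X u).card = k := by
  have h := Fin.card_filter_parity u (Nat.zero_le _) hu hsn
  rw [show (u.val - 0 + 1) / 2 + (s - 1 - u.val) / 2 = k by omega] at h
  rw [← h, lowerBeaters]
  congr 1
  ext w
  simp only [Finset.mem_filter, Finset.mem_univ, true_and, Nat.zero_le]
  exact and_congr_right fun hw => blockTournament_beats_lower hu hw

theorem losses_blockTournament_lower {k : ℕ} (hs : s = 2 * k + 1) (hsn : s ≤ n) {u : Fin n}
    (hu : u.val < s) : (blockTournament n s X).losses u =
      k + (Finset.univ.filter fun w : Fin n => s ≤ w.val ∧ X u w = true).card := by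
  rw [← card_lowerBeaters (X := X) hs hsn hu, lowerBeaters, ← Finset.card_union_of_disjoint,
    Tournament.losses]
  · congr 1
    ext w
    simp only [Finset.mem_filter, Finset.mem_univ, true_and, Finset.mem_union]
    rcases lt_or_ge w.val s with hw | hw
    · simp [hw, not_le.2 hw]
    · simp [hw, not_lt.2 hw, blockTournament_beats_of_lt_of_le hu hw]
  · rw [Finset.disjoint_filter]
    intro w _ h1 h2
    omega

/-- A large upper block already causes `l` losses internally, whatever `X` is. -/
theorem le_losses_blockTournament_upper {l : ℕ} (hs : s + (2 * l + 2) ≤ n) {u : Fin n}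
    (hu : s ≤ u.val) : l ≤ (blockTournament n s X).losses u := by
  have h := Fin.card_filter_parity u hu u.isLt le_rfl
  have : l ≤ (u.val - s + 1) / 2 + (n - 1 - u.val) / 2 := by omega
  rw [← h] at this
  refine this.trans (Finset.card_le_card fun w => ?_)
  simp only [Finset.mem_filter, Finset.mem_univ, true_and]
  rintro ⟨hw, h⟩
  exact (blockTournament_beats_upper hu hw.1).2 h

/-- Here the upper block may be small, so the losses to the dominating block are counted instead. -/
theorem le_losses_blockTournament_upper_of_dominated (hsn : s ≤ n) {u : Fin n}
    (hu : s ≤ u.val) : s ≤ (blockTournament n s fun _ _ => false).losses u := by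
  have : (Finset.univ.filter fun w : Fin n => w.val < s).card = s := by
    simp [Fin.card_filter_val_lt, hsn]
  conv_lhs => rw [← this]
  refine Finset.card_le_card fun w => ?_
  simp only [Finset.mem_filter, Finset.mem_univ, true_and]
  intro hw
  rw [blockTournament_beats_of_le_of_lt hu hw]
  rfl

end blockTournament

theorem losses_dominatingBlock {n l : ℕ} (h : 2 * l + 1 ≤ n) {u : Fin n}
    (hu : u.val < 2 * l + 1) :
    (blockTournament n (2 * l + 1) fun _ _ => false).losses u = l := by
  rw [losses_blockTournament_lower rfl h hu]
  simp

theorem isChampion_dominatingBlock {n l : ℕ} (h : 2 * l + 1 ≤ n) {u : Fin n}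
    (hu : u.val < 2 * l + 1) :
    (blockTournament n (2 * l + 1) fun _ _ => false).IsChampion u := by
  rw [Tournament.isChampion_iff_losses]
  intro w
  rw [losses_dominatingBlock h hu]
  rcases lt_or_ge w.val (2 * l + 1) with hw | hw
  · rw [losses_dominatingBlock h hw]
  · have := le_losses_blockTournament_upper_of_dominated h hw
    omega

theorem championLoses_dominatingBlock {n l : ℕ} (h : 2 * l + 1 ≤ n) :
    (blockTournament n (2 * l + 1) fun _ _ => false).ChampionLoses l :=
  ⟨⟨0, by omega⟩, isChampion_dominatingBlock h (by simp), losses_dominatingBlock h (by simp)⟩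

/-! ### Planted losses -/

/-- Each vertex `u` of the lower block loses to `f u`, if that is in the upper block, and to no
other vertex there. -/
def plantedTournament (n s : ℕ) (f : Fin n → Fin n) : Tournament (Fin n) :=
  blockTournament n s fun u w => decide (f u = w)

section plantedTournament

variable {n s l : ℕ} (f : Fin n → Fin n)

theorem plantedTournament_beats {u : Fin n} (hu : u.val < s) (hf : s ≤ (f u).val) :
    (plantedTournament n s f).beats (f u) u = true := by
  rw [plantedTournament, blockTournament_beats_of_lt_of_le hu hf]
  simp

/-- Size `2l-1` gives `l-1` losses inside the block; the planted one makes `l`. -/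
theorem losses_plantedTournament (hs : s + 1 = 2 * l) (hsn : s ≤ n) {u : Fin n}
    (hu : u.val < s) (hf : s ≤ (f u).val) : (plantedTournament n s f).losses u = l := by
  rw [plantedTournament, losses_blockTournament_lower (k := l - 1) (by omega) hsn hu]
  have : (Finset.univ.filter fun w : Fin n => s ≤ w.val ∧ decide (f u = w) = true)
      = {f u} := by
    ext w
    simp only [Finset.mem_filter, Finset.mem_univ, true_and, Finset.mem_singleton,
      decide_eq_true_eq]
    exact ⟨fun h => h.2.symm, fun h => ⟨h ▸ hf, h.symm⟩⟩
  rw [this, Finset.card_singleton]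
  omega

theorem isChampion_plantedTournament (hs : s + 1 = 2 * l) (hsn : s + (2 * l + 2) ≤ n)
    (hf : ∀ v, s ≤ (f v).val) {u : Fin n} (hu : u.val < s) :
    (plantedTournament n s f).IsChampion u := by
  rw [Tournament.isChampion_iff_losses]
  intro w
  rw [losses_plantedTournament f hs (by omega) hu (hf u)]
  rcases lt_or_ge w.val s with hw | hw
  · rw [losses_plantedTournament f hs (by omega) hw (hf w)]
  · exact le_losses_blockTournament_upper hsn hw

/-- The value `u` at `u` is a placeholder: it lies in the upper block only when `u` does, and then
it is never read, so it plants no loss. This gives the reference tournament for `mul_card_found_le`.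
-/
theorem plantedTournament_update_beats (u w : Fin n) {x y : Fin n} (h : s(x, y) ≠ s(u, w)) :
    (plantedTournament n s (Function.update f u w)).beats x y =
      (plantedTournament n s (Function.update f u u)).beats x y := by
  by_cases hxy : x = y
  · rw [hxy, Tournament.irrefl, Tournament.irrefl]
  have key : ∀ a b : Fin n, a ≠ b → s(a, b) ≠ s(u, w) →
      decide (Function.update f u w a = b) = decide (Function.update f u u a = b) := by
    intro a b hab h
    by_cases ha : a = u
    · subst ha
      have : w ≠ b := by rintro rfl; exact h rfl
      simp [this, hab]
    · simp [ha]
  have k1 := key x y hxy h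
  have k2 := key y x (Ne.symm hxy) (by rwa [Sym2.eq_swap])
  simp only [plantedTournament, blockTournament, k1, k2]

end plantedTournament

/-! ### Bounds of order `n` and `l ^ 2` -/

namespace RandomizedAlgorithm

/-- On any tournament, the algorithm has to look at most of the vertices, since a vertex that it
does not look at might beat all others. -/
theorem mul_le_of_expectedLookups_le {n : ℕ} (A : RandomizedAlgorithm (Fin n)) {p X : ℝ}
    (hA : ∀ T : Tournament (Fin n), ENNReal.ofReal p ≤ successProb A T) (hX : 0 ≤ X)
    (T : Tournament (Fin n)) (hT : expectedLookups A T ≤ ENNReal.ofReal X) :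
    n * p ≤ 1 + 2 * X := by
  have h := real_mul_card_mul_le A hX hA Finset.univ {()} (fun u => T.promote u Finset.univ)
    (fun u => u) (fun _ => T) (fun u _ v hv => T.eq_of_isChampion_promote_univ u v hv) 1 1 2
    (fun t => ?_) (fun _ _ => hT)
  · simpa using h
  rw [one_mul, Finset.sum_singleton]
  -- If `u` is untouched, the answer is the one on `T`; this single exception is the `1` in the
  -- bound, and the `2` is the number of ends of an arc.
  have h1 : (Finset.univ.filter fun u => t.result (T.promote u Finset.univ) = u) ⊆
      insert (t.result T) (Finset.univ.filter fun u => t.lookupsAt T u ≠ 0) := by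
    intro u hu
    simp only [Finset.mem_filter, Finset.mem_univ, true_and, Finset.mem_insert] at hu ⊢
    by_contra! hc
    obtain ⟨hc1, hc2⟩ := hc
    rw [LookupTree.lookupsAt, List.countP_eq_zero] at hc2
    refine hc1 (hu.symm.trans (LookupTree.result_eq_of_agree fun x y hxy => ?_))
    have := hc2 _ hxy
    simp only [Sym2.mem_iff, decide_eq_true_eq, not_or] at this
    exact T.promote_beats_of_ne _ (Ne.symm this.1) (Ne.symm this.2)
  have h2 : (Finset.univ.filter fun u => t.lookupsAt T u ≠ 0).card ≤ ∑ u, t.lookupsAt T u := by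
    rw [Finset.card_filter]
    refine Finset.sum_le_sum fun u _ => ?_
    split_ifs <;> omega
  have h3 := (Finset.card_le_card h1).trans (Finset.card_insert_le _ _)
  have h4 := t.sum_lookupsAt_le T
  omega

/-- If `2 * l + 1` vertices form a regular tournament and beat all others, then the algorithm has
to look up many of the arcs between them. -/
theorem mul_le_of_expectedLookups_dominatingBlock_le {n l : ℕ} (A : RandomizedAlgorithm (Fin n))
    {p X : ℝ} (hA : ∀ T : Tournament (Fin n), ENNReal.ofReal p ≤ successProb A T) (hX : 0 ≤ X)
    (hl : 2 * l + 1 ≤ n)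
    (hT : expectedLookups A (blockTournament n (2 * l + 1) fun _ _ => false) ≤
      ENNReal.ofReal X) :
    (2 * l + 1) * l * p ≤ l + X := by
  set s := 2 * l + 1 with hs
  set T := blockTournament n s fun _ _ => false with hTdef
  let C : Finset (Fin n) := Finset.univ.filter fun u => u.val < s
  let I : Finset (Σ _ : Fin n, Fin n) := C.sigma fun u => lowerBeaters n s (fun _ _ => false) u
  have hC : C.card = s := by simp [C, Fin.card_filter_val_lt, hl]
  have hI : I.card = s * l := by
    rw [Finset.card_sigma, Finset.sum_const_nat (m := l), hC]
    intro u hu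
    exact card_lowerBeaters hs hl (Finset.mem_filter.1 hu).2
  have hmem : ∀ i ∈ I, i.1.val < s ∧ T.beats i.2 i.1 = true := by
    intro i hi
    obtain ⟨h1, h2⟩ := Finset.mem_sigma.1 hi
    exact ⟨(Finset.mem_filter.1 h1).2, (Finset.mem_filter.1 h2).2.2⟩
  have h := real_mul_card_mul_le A hX hA I {()} (fun i => T.promote i.1 {i.2})
    (fun i => i.1) (fun _ => T)
    (fun i hi v hv => T.eq_of_isChampion_promote_singleton v
      (isChampion_dominatingBlock hl (hmem i hi).1) (hmem i hi).2 hv) 1 l 1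
    (fun t => ?_) (fun _ _ => hT)
  · rw [hI] at h
    simpa [hs] using h
  rw [one_mul, one_mul, Finset.sum_singleton]
  have h1 : (I.filter fun i => t.result (T.promote i.1 {i.2}) = i.1) ⊆
      (I.filter fun i => i.1 = t.result T) ∪ (I.filter fun i => s(i.1, i.2) ∈ t.trace T) := by
    intro i hi
    simp only [Finset.mem_filter, Finset.mem_union] at hi ⊢
    by_contra! hc
    refine hc.1 hi.1 (hi.2.symm.trans (LookupTree.result_eq_of_agree fun x y hxy => ?_))
    refine T.promote_singleton_beats fun h => hc.2 hi.1 ?_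
    rwa [← h]
  -- The vertex output on `T` is right without any search, but it has only `l` incoming arcs in the
  -- block.
  have h2 : (I.filter fun i => i.1 = t.result T).card ≤ l := by
    by_cases hr : (t.result T).val < s
    · rw [← card_lowerBeaters (X := fun _ _ => false) hs hl hr]
      refine Finset.card_le_card_of_injOn (fun i => i.2) ?_ ?_
      · rintro ⟨u, w⟩ hi
        simp only [Finset.coe_filter, Set.mem_ofPred_eq, I, Finset.mem_sigma] at hi
        obtain ⟨⟨_, h⟩, rfl⟩ := hi
        exact h
      · rintro ⟨u, w⟩ hi ⟨u', w'⟩ hi' h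
        simp only [Finset.coe_filter, Set.mem_ofPred_eq] at hi hi' h
        rw [hi.2, hi'.2, h]
    · rw [Finset.filter_eq_empty_iff.2, Finset.card_empty]
      · exact Nat.zero_le _
      · intro i hi h
        exact hr (h ▸ (hmem i hi).1)
  have h3 : (I.filter fun i => s(i.1, i.2) ∈ t.trace T).card ≤ t.lookups T := by
    rw [← LookupTree.length_trace]
    refine le_trans ?_ (List.toFinset_card_le _)
    refine Finset.card_le_card_of_injOn (fun i => s(i.1, i.2)) ?_ ?_
    · intro i hi
      simpa using (Finset.mem_filter.1 hi).2
    · rintro ⟨u, w⟩ hi ⟨u', w'⟩ hi' h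
      have hb := (hmem _ (Finset.mem_filter.1 hi).1).2
      have hb' := (hmem _ (Finset.mem_filter.1 hi').1).2
      simp only [Sym2.eq_iff] at h
      obtain ⟨rfl, rfl⟩ | ⟨rfl, rfl⟩ := h
      · rfl
      · have hne : u ≠ w := by rintro rfl; simp [T.irrefl] at hb
        have := T.compl u w hne
        simp_all
  exact (Finset.card_le_card h1).trans ((Finset.card_union_le _ _).trans (Nat.add_le_add h2 h3))

end RandomizedAlgorithm

/-! ### The bound of order `l n` from random planted losses -/

/-- Resampling one coordinate does not change a sum over all functions into `R`. -/
theorem Fintype.sum_piFinset_update {α β M : Type*} [Fintype α] [DecidableEq α] [DecidableEq β]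
    [AddCommMonoid M] (R : Finset β) (u : α) (g : (α → β) → M) :
    ∑ f ∈ Fintype.piFinset fun _ : α => R, ∑ w ∈ R, g (Function.update f u w) =
      R.card • ∑ f ∈ Fintype.piFinset fun _ : α => R, g f := by
  rw [← Finset.sum_nsmul]
  simp only [← Finset.sum_const]
  rw [← Finset.sum_product', ← Finset.sum_product']
  -- Exchanging `w` with the value at `u` is an involution.
  refine Finset.sum_nbij' (fun q => (Function.update q.1 u q.2, q.1 u))
    (fun q => (Function.update q.1 u q.2, q.1 u)) ?_ ?_ ?_ ?_ ?_
  · rintro ⟨f, w⟩ h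
    simp only [Finset.mem_product, Fintype.mem_piFinset] at h ⊢
    refine ⟨fun a => ?_, h.1 u⟩
    by_cases ha : a = u
    · subst ha; simpa using h.2
    · simpa [ha] using h.1 a
  · rintro ⟨f, w⟩ h
    simp only [Finset.mem_product, Fintype.mem_piFinset] at h ⊢
    refine ⟨fun a => ?_, h.1 u⟩
    by_cases ha : a = u
    · subst ha; simpa using h.2
    · simpa [ha] using h.1 a
  · rintro ⟨f, w⟩ h
    simp
  · rintro ⟨f, w⟩ h
    simp
  · rintro ⟨f, w⟩ h
    simp

/-- With the other values of `f` fixed, `f u` ranges uniformly over `R` and `mul_card_found_le`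
applies; resampling `f u` then averages over `f`, at the price of a factor `R.card`. -/
theorem LookupTree.mul_card_planted_le {n s : ℕ} (t : LookupTree (Fin n)) (R : Finset (Fin n))
    (b : ℕ) (u : Fin n) :
    b * (R.card * ((Fintype.piFinset fun _ : Fin n => R).filter fun f =>
      s(u, f u) ∈ t.trace (plantedTournament n s f)).card) ≤
    (Fintype.piFinset fun _ : Fin n => R).card * b ^ 2 +
      R.card * ∑ f ∈ Fintype.piFinset fun _ : Fin n => R,
        t.lookupsAt (plantedTournament n s f) u := by
  have h1 := Fintype.sum_piFinset_update R u fun f : Fin n → Fin n =>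
    if s(u, f u) ∈ t.trace (plantedTournament n s f) then 1 else 0
  have h2 := Fintype.sum_piFinset_update R u fun f : Fin n → Fin n =>
    t.lookupsAt (plantedTournament n s f) u
  rw [smul_eq_mul] at h1 h2
  rw [Finset.card_filter, ← h1, ← h2, Finset.mul_sum, ← smul_eq_mul (Finset.card _),
    ← Finset.sum_const, ← Finset.sum_add_distrib]
  refine Finset.sum_le_sum fun f _ => ?_
  have h := mul_card_found_le (plantedTournament n s (Function.update f u u)) u
    (fun w => plantedTournament n s (Function.update f u w))
    (fun w x y hxy => plantedTournament_update_beats f u w hxy) t b R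
  simpa only [Finset.card_filter, Function.update_self] using h

/-- A right answer means that `u` is the output on the planted tournament, which holds for one `u`
per `f`, or that the planted arc at `u` was looked up there. -/
theorem LookupTree.mul_card_result_planted_le {n s : ℕ} (t : LookupTree (Fin n))
    (R C : Finset (Fin n)) (b : ℕ) :
    (b * R.card) * (((Fintype.piFinset fun _ : Fin n => R) ×ˢ C).filter fun i =>
      t.result ((plantedTournament n s i.1).promote i.2 {i.1 i.2}) = i.2).card ≤
    (b * R.card * (Fintype.piFinset fun _ : Fin n => R).card +
      C.card * (Fintype.piFinset fun _ : Fin n => R).card * b ^ 2) +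
      (2 * R.card) * ∑ f ∈ Fintype.piFinset fun _ : Fin n => R,
        t.lookups (plantedTournament n s f) := by
  set J := Fintype.piFinset fun _ : Fin n => R
  have h1 : ((J ×ˢ C).filter fun i =>
      t.result ((plantedTournament n s i.1).promote i.2 {i.1 i.2}) = i.2) ⊆
      ((J ×ˢ C).filter fun i => t.result (plantedTournament n s i.1) = i.2) ∪
      ((J ×ˢ C).filter fun i => s(i.2, i.1 i.2) ∈ t.trace (plantedTournament n s i.1)) := by
    intro i hi
    simp only [Finset.mem_filter, Finset.mem_union] at hi ⊢
    by_contra! hc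
    refine hc.1 hi.1 ((LookupTree.result_eq_of_agree fun x y hxy => ?_).symm.trans hi.2)
    refine Tournament.promote_singleton_beats _ fun h => hc.2 hi.1 ?_
    rwa [← h]
  have h2 : ((J ×ˢ C).filter fun i => t.result (plantedTournament n s i.1) = i.2).card ≤
      J.card := by
    refine Finset.card_le_card_of_injOn (fun i => i.1) ?_ ?_
    · intro i hi
      exact (Finset.mem_product.1 (Finset.mem_filter.1 hi).1).1
    · rintro ⟨f, u⟩ hi ⟨f', u'⟩ hi' h
      simp only [Finset.coe_filter, Set.mem_ofPred_eq] at hi hi' h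
      subst h
      rw [← hi.2, ← hi'.2]
  have h3 : ((J ×ˢ C).filter fun i =>
      s(i.2, i.1 i.2) ∈ t.trace (plantedTournament n s i.1)).card =
      ∑ u ∈ C, (J.filter fun f => s(u, f u) ∈ t.trace (plantedTournament n s f)).card := by
    simp only [Finset.card_filter]
    rw [Finset.sum_product_right]
  have h4 : ∑ u ∈ C, ∑ f ∈ J, t.lookupsAt (plantedTournament n s f) u ≤
      2 * ∑ f ∈ J, t.lookups (plantedTournament n s f) := by
    rw [Finset.sum_comm, Finset.mul_sum]
    refine Finset.sum_le_sum fun f _ => le_trans ?_ (t.sum_lookupsAt_le _)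
    exact Finset.sum_le_sum_of_subset (Finset.subset_univ C)
  have h5 := Finset.sum_le_sum fun u (_ : u ∈ C) => t.mul_card_planted_le (s := s) R b u
  rw [← Finset.mul_sum, ← Finset.mul_sum, Finset.sum_add_distrib, Finset.sum_const, smul_eq_mul,
    ← Finset.mul_sum, ← h3] at h5
  have h6 := (Finset.card_le_card h1).trans ((Finset.card_union_le _ _).trans
    (Nat.add_le_add_right h2 _))
  calc _ ≤ b * R.card * _ := Nat.mul_le_mul_left _ h6
    _ = b * R.card * J.card + b * (R.card * _) := by rw [mul_add]; congr 1; rw [mul_assoc]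
    _ ≤ b * R.card * J.card + _ := Nat.add_le_add_left h5 _
    _ ≤ b * R.card * J.card + (C.card * (J.card * b ^ 2) + R.card * _) :=
        Nat.add_le_add_left (Nat.add_le_add_left (Nat.mul_le_mul_left _ h4) _) _
    _ = _ := by ring

/-- If each vertex of a regular tournament on `s` vertices loses to one random vertex among many
outsiders, then the algorithm has to find many of these losses. -/
theorem RandomizedAlgorithm.le_of_expectedLookups_planted_le {n s l : ℕ}
    (A : RandomizedAlgorithm (Fin n)) {p X : ℝ}
    (hA : ∀ T : Tournament (Fin n), ENNReal.ofReal p ≤ successProb A T) (hX : 0 ≤ X)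
    (hs : s + 1 = 2 * l) (hsn : s + (2 * l + 2) ≤ n)
    (hT : ∀ T : Tournament (Fin n), T.ChampionLoses l → expectedLookups A T ≤ ENNReal.ofReal X)
    (b : ℕ) :
    b * (n - s : ℝ) * s * p ≤ b * (n - s : ℝ) + s * (b : ℝ) ^ 2 + 2 * (n - s : ℝ) * X := by
  let C : Finset (Fin n) := Finset.univ.filter fun u => u.val < s
  let R : Finset (Fin n) := Finset.univ.filter fun u => s ≤ u.val
  let J := Fintype.piFinset fun _ : Fin n => R
  have hC : C.card = s := by
    have : s ≤ n := by omega
    simp [C, Fin.card_filter_val_lt, this]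
  have hR : (R.card : ℝ) = n - s := by
    have h := Finset.card_filter_add_card_filter_not (s := Finset.univ)
      (fun u : Fin n => u.val < s)
    rw [Finset.card_univ, Fintype.card_fin] at h
    simp only [not_lt] at h
    change C.card + R.card = n at h
    rw [hC] at h
    rw [eq_sub_iff_add_eq', ← Nat.cast_add, h]
  have hJ : ∀ f ∈ J, ∀ v, s ≤ (f v).val := fun f hf v =>
    (Finset.mem_filter.1 (Fintype.mem_piFinset.1 hf v)).2
  have hJ0 : 0 < J.card := by
    rw [Fintype.card_piFinset_const]
    refine pow_pos (Finset.card_pos.2 ⟨⟨s, by omega⟩, by simp [R]⟩) _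
  have h := real_mul_card_mul_le A hX hA (J ×ˢ C) J
    (fun i => (plantedTournament n s i.1).promote i.2 {i.1 i.2}) (fun i => i.2)
    (fun f => plantedTournament n s f)
    (fun i hi v hv => by
      obtain ⟨h1, h2⟩ := Finset.mem_product.1 hi
      have h2 := (Finset.mem_filter.1 h2).2
      exact Tournament.eq_of_isChampion_promote_singleton _ v
        (isChampion_plantedTournament _ hs hsn (hJ _ h1) h2)
        (plantedTournament_beats _ h2 (hJ _ h1 _)) hv)
    _ _ _ (fun t => t.mul_card_result_planted_le R C b)
    (fun f hf => hT _ ⟨⟨0, by omega⟩,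
      isChampion_plantedTournament _ hs hsn (hJ f hf) (by simp only; omega),
      losses_plantedTournament _ hs (by omega) (by simp only; omega) (hJ f hf _)⟩)
  rw [Finset.card_product, hC] at h
  push_cast at h
  rw [hR] at h
  have hJ0' : (0 : ℝ) < J.card := by exact_mod_cast hJ0
  refine le_of_mul_le_mul_left ?_ hJ0'
  change _ ≤ (b * (n - s : ℝ) * J.card + s * J.card * b ^ 2) + _ at h
  linarith

/-! ### Combining the three bounds -/

theorem mainTheorem3 (p : ℝ) (hp : 0 < p) :
    ∃ c : ℝ, 0 < c ∧ ∃ N : ℕ, ∀ n : ℕ, N ≤ n → ∀ A : RandomizedAlgorithm (Fin n),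
      (∀ T : Tournament (Fin n), ENNReal.ofReal p ≤ RandomizedAlgorithm.successProb A T) →
      ∀ l : ℕ, 2 * l + 1 ≤ n →
        ∃ T : Tournament (Fin n), T.ChampionLoses l ∧
          ENNReal.ofReal (c * (l : ℝ) * (n : ℝ)) < RandomizedAlgorithm.expectedLookups A T := by
  -- One factor `p` is the fraction of candidates whose arc must be found, the other comes from the
  -- search length `b` of order `p n`.
  refine ⟨p ^ 2 / 64, by positivity, ⌈16 / p⌉₊, fun n hn A hA l hl => ?_⟩
  have hnp : 16 ≤ n * p := by
    have := (Nat.le_ceil _).trans (Nat.cast_le (α := ℝ).2 hn)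
    rwa [div_le_iff₀ hp] at this
  have hp1 : p ≤ 1 := by
    have : ENNReal.ofReal p ≤ 1 := by
      refine (hA (blockTournament n 0 fun _ _ => false)).trans ?_
      rw [RandomizedAlgorithm.successProb, PMF.toOuterMeasure_apply, ← A.tsum_coe]
      exact ENNReal.tsum_le_tsum fun t => Set.indicator_le_self' (by simp) t
    simpa using this
  have hn0 : (0 : ℝ) < n := by
    by_contra! h
    nlinarith
  by_contra! hT
  set X : ℝ := p ^ 2 / 64 * l * n with hXdef
  have hX : 0 ≤ X := by positivity
  have hTd := hT _ (championLoses_dominatingBlock hl)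
  have h1 := A.mul_le_of_expectedLookups_le hA hX _ hTd
  -- small `l` is excluded
  have hlp : 4 < l * p := by
    by_contra! h
    have : X ≤ p * n / 16 := by
      calc X = (l * p) * (p * n / 64) := by rw [hXdef]; ring
        _ ≤ 4 * (p * n / 64) := by gcongr
        _ = _ := by ring
    nlinarith
  have hl0 : (0 : ℝ) < l := by
    by_contra! h
    nlinarith
  -- `4l+1 = (2l-1) + (2l+2)` is the least size at which the planted construction fits; below it, `l
  -- ^ 2` is of order `l n`.
  rcases Nat.lt_or_ge n (4 * l + 1) with hnl | hnl
  · have h2 := A.mul_le_of_expectedLookups_dominatingBlock_le hA hX hl hTd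
    have h3 : (2 * l + 1) * p ≤ 1 + p ^ 2 / 64 * n := by
      refine le_of_mul_le_mul_left ?_ hl0
      calc (l : ℝ) * ((2 * l + 1) * p) = (2 * l + 1) * l * p := by ring
        _ ≤ l + X := h2
        _ = _ := by rw [hXdef]; ring
    have h4 : (n : ℝ) ≤ 4 * l := by exact_mod_cast Nat.lt_succ_iff.1 hnl
    have h5 : p ^ 2 / 64 * n ≤ p * n / 64 := by
      calc p ^ 2 / 64 * n = p * (p * n / 64) := by ring
        _ ≤ 1 * (p * n / 64) := by gcongr
        _ = _ := one_mul _
    nlinarith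
  · have hl1 : 1 ≤ l := by
      by_contra! h
      simp [Nat.lt_one_iff.1 h] at hl0
    obtain ⟨s, hs⟩ : ∃ s, s + 1 = 2 * l := ⟨2 * l - 1, by omega⟩
    have hsl : (s : ℝ) + 1 = 2 * l := by exact_mod_cast hs
    have hm : (n : ℝ) / 2 ≤ n - s := by
      have : (4 * l + 1 : ℝ) ≤ n := by exact_mod_cast hnl
      linarith
    set m : ℝ := n - s
    -- Arcs found within `b` lookups then account for at most half of the required fraction `p`.
    set b := ⌊m * p / 2⌋₊ with hb
    have hb1 : (b : ℝ) ≤ m * p / 2 := Nat.floor_le (by nlinarith)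
    have hb2 : n * p / 8 ≤ b := by
      have := Nat.lt_floor_add_one (m * p / 2)
      rw [← hb] at this
      nlinarith
    have h2 := A.le_of_expectedLookups_planted_le hA hX hs (by omega) hT b
    change b * m * s * p ≤ b * m + s * (b : ℝ) ^ 2 + 2 * m * X at h2
    have hb0 : (0 : ℝ) < b := by linarith
    have hm0 : 0 < m := by linarith
    have hl1' : (1 : ℝ) ≤ l := by exact_mod_cast hl1
    have h3 : X ≤ b * (p * l / 8) := by
      calc X = (n * p / 8) * (p * l / 8) := by rw [hXdef]; ring
        _ ≤ _ := by gcongr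
    have h4 : s * p ≤ 1 + s * (p / 2) + p * l / 4 := by
      have hbm : 0 < b * m := by positivity
      refine le_of_mul_le_mul_left ?_ hbm
      have e1 : s * (b : ℝ) ^ 2 ≤ s * (b * (m * p / 2)) := by
        rw [sq]; gcongr
      have e2 : 2 * m * X ≤ 2 * m * (b * (p * l / 8)) := by gcongr
      linarith
    -- As `s = 2l-1`, `h4` bounds `l p` by `2`, against `hlp`.
    nlinarith
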